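/- Let $\mathbb N=\{1,2,\dots\}$ and $d\in\mathbb N$. Let $\nu\neq\delta_0$ be a probability measure on $\mathbb R$ that is symmetric and has compact support. Let $\phi_1,\phi_2,\dots$ be i.i.d. $\mathbb R^d$-valued increments with law $\eta(\mathrm d\phi)=\prod_{p=1}^d\nu(\mathrm d\phi^p)$, and let $\mathbb P$ be the law of the trajectory $x=(x_0,\dots,x_T)$, where $x_0=0$ and $x_j=\phi_1+\dots+\phi_j$. Let $W:\mathbb R^d\times\mathbb N\to\mathbb R$ be of the form $$W(z,t)=\sum_{i=1}^{n(t)}c_{i,t}\Big(\sum_{p=1}^d (z^p)^q\Big)^i,\qquad z=(z^1,\dots,z^d)\in\mathbb R^d,\ t\in\mathbb N,$$ where $q\in\mathbb N$ is fixed and $c_{i,t}\ge 0$ for all $t\in\mathbb N$ and $1\le i\le n(t)$. For $\alpha>0$ and $T\in\mathbb N$ let $$\hat{\mathbb P}_{\alpha,T}(\mathrm dx)=\frac1{Z_{\alpha,T}}\exp\Big(\alpha\sum_{0\le i<j\le T}W(x_j-x_i,\,j-i)\Big)\,\mathbb P(\mathrm dx),$$ where $Z_{\alpha,T}$ is the normalizing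 constant. Assume that there is an even $i$ with $1\le i\le n(2)$ and $c_{i,2}>0$, and set $\zeta:=c_{i,2}$. Then there exist constants $C>0$ and $a>0$, which do not depend on $\alpha$, such that for all $\alpha\ge 1$ $$\limsup_{T\to\infty}\frac1{dT}\,\mathbb E^{\hat{\mathbb P}_{\alpha,T}}\big[\|x_T\|^2\big]\ \ge\ C\,e^{a\zeta\alpha},$$ where $\|\cdot\|$ is the Euclidean norm and the limit superior is taken in $[0,\infty]$. -/

import Mathlib

open MeasureTheory Filter

noncomputable section

/-- The law on `ℝ^d` of one increment of a product walk: the `d` coordinates are independent,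
each with law `ν`. -/
def stepLaw (d : ℕ) (ν : Measure ℝ) : Measure (Fin d → ℝ) :=
  Measure.pi fun _ : Fin d => ν

/-- The trajectory `(x_0, …, x_T)` with increments `φ_1, …, φ_T`, where `x_j = φ_1 + ⋯ + φ_j`.
The increment `φ_{k+1}` is stored at the index `k : Fin T`. -/
def walk {d T : ℕ} (φ : Fin T → Fin d → ℝ) : Fin (T + 1) → Fin d → ℝ :=
  fun j => ∑ k : Fin T with k.val < j.val, φ k

/-- The law `ℙ` on trajectories `(x_0, …, x_T)` of the product walk with i.i.d. increments
of law `stepLaw d ν`. -/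
def walkLaw (d : ℕ) (ν : Measure ℝ) (T : ℕ) : Measure (Fin (T + 1) → Fin d → ℝ) :=
  (Measure.pi fun _ : Fin T => stepLaw d ν).map walk

/-- The total interaction `∑_{0 ≤ i < j ≤ T} W(x_j - x_i, j - i)` of a trajectory. -/
def interaction {d T : ℕ} (W : (Fin d → ℝ) → ℕ → ℝ) (x : Fin (T + 1) → Fin d → ℝ) : ℝ :=
  ∑ i : Fin (T + 1), ∑ j : Fin (T + 1) with i < j, W (x j - x i) (j.val - i.val)

/-- The reweighted path measure `Z⁻¹ exp (α ∑_{i < j} W(x_j - x_i, j - i)) ℙ(dx)`;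
`Measure.tilted` includes the normalization by `Z = ∫ exp (…) dℙ`. -/
def perturbedLaw (d : ℕ) (ν : Measure ℝ) (W : (Fin d → ℝ) → ℕ → ℝ) (α : ℝ) (T : ℕ) :
    Measure (Fin (T + 1) → Fin d → ℝ) :=
  (walkLaw d ν T).tilted fun x => α * interaction W x

/-- The mean-square displacement `𝔼[‖x_T‖²]` (Euclidean norm) under the reweighted path measure. -/
def meanSquareDisplacement (d : ℕ) (ν : Measure ℝ) (W : (Fin d → ℝ) → ℕ → ℝ) (α : ℝ) (T : ℕ) :
    ℝ :=
  ∫ x, ‖(WithLp.toLp 2 (x (Fin.last T)) : EuclideanSpace ℝ (Fin d))‖ ^ 2 ∂(perturbedLaw d ν W α T)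

/-- The standing assumption on the pair potential: at each time difference `t ≥ 1`, `W(·, t)` is
the polynomial `∑_{i=1}^{n(t)} c_{i,t} (∑_p (z^p)^q)^i` with nonnegative coefficients and a fixed
exponent `q ≥ 1`, and at `t = 2` some coefficient is positive. -/
structure IsSelfRepelling {d : ℕ} (W : (Fin d → ℝ) → ℕ → ℝ) (q : ℕ) (n : ℕ → ℕ)
    (c : ℕ → ℕ → ℝ) : Prop where
  one_le_exponent : 1 ≤ q
  eq_sum : ∀ t : ℕ, 1 ≤ t → ∀ z : Fin d → ℝ,
    W z t = ∑ i ∈ Finset.Icc 1 (n t), c i t * (∑ p : Fin d, z p ^ q) ^ i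
  coeff_nonneg : ∀ t : ℕ, 1 ≤ t → ∀ i ∈ Finset.Icc 1 (n t), 0 ≤ c i t
  exists_coeff_pos : ∃ i ∈ Finset.Icc 1 (n 2), 0 < c i 2

end

/-! Expanding $\|x_T\|^2$ gives the sum of the correlations $\langle\phi_j^p\phi_k^p\rangle$ of the
increments. Since the coefficients of $W$ are nonnegative, the interaction is a polynomial in the
increments with nonnegative coefficients: a ferromagnetic system, to which Griffiths inequalities
apply.

These come from Ginibre's duplication. For two independent copies, $F(x)\pm F(y)$ lies in a cone
generated by products over sites of $(x+y)^a(x-y)^b k$ with $k\ge0$ symmetric, and such products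
have nonnegative integral by parity. Hence $\langle FG\rangle\ge\langle F\rangle\langle G\rangle$
(`gibbs_mul_le`), and enlarging the Hamiltonian within the cone increases expectations
(`gibbs_le_gibbs_add`).

Let $s_j$ be the sign of $\phi_j^p$, set to zero when $|\phi_j^p|<r$. For neighbours, keep only the
term $\alpha\zeta(\phi_j^p+\phi_{j+1}^p)^{qi}$ at time difference 2. Its even power favours two
large increments of the same sign, so $\langle s_js_{j+1}\rangle\ge1-\varepsilon$ with
$\varepsilon\le Ke^{-a\zeta\alpha}$ (`le_gibbs_stepSign_pair`). Correlations multiply along the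
chain (`gibbs_stepSign_mul_trans`), so $\langle s_js_k\rangle\ge\delta(1-\varepsilon)^{|j-k|}$. They
bound the true correlations from below (`gibbs_stepSign_le_gibbs_coord`), and the geometric series
contributes order $1/\varepsilon$ per increment. -/

noncomputable section
open Topology

/-! ### Positive families and the cones they generate -/

/-- A multiplicative family of measurable, essentially bounded functions with nonnegative
integrals. -/
structure IsPositiveFamily {E : Type*} [MeasurableSpace E] (μ : Measure E)
    (A : Submonoid (E → ℝ)) : Prop where
  measurable : ∀ f ∈ A, Measurable f
  bounded : ∀ f ∈ A, ∃ B, ∀ᵐ x ∂μ, |f x| ≤ B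
  integral_nonneg : ∀ f ∈ A, 0 ≤ ∫ x, f x ∂μ

/-- The products over the sites of functions of the family `A`. -/
def piFamily (ι : Type*) [Fintype ι] {E : Type*} (A : Submonoid (E → ℝ)) :
    Submonoid ((ι → E) → ℝ) where
  carrier := {f | ∃ h : ι → E → ℝ, (∀ i, h i ∈ A) ∧ f = fun z => ∏ i, h i (z i)}
  one_mem' := ⟨fun _ => 1, fun _ => A.one_mem, by ext; simp⟩
  mul_mem' := by
    rintro _ _ ⟨h, hh, rfl⟩ ⟨g, hg, rfl⟩
    exact ⟨fun i => h i * g i, fun i => A.mul_mem (hh i) (hg i), by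
      ext z; simp [Finset.prod_mul_distrib]⟩

theorem comp_eval_mem_piFamily {ι E : Type*} [Fintype ι] {A : Submonoid (E → ℝ)}
    {f : E → ℝ} (hf : f ∈ A) (i : ι) : (fun z : ι → E => f (z i)) ∈ piFamily ι A := by
  classical
  refine ⟨Function.update (fun _ => 1) i f, fun j => ?_, ?_⟩
  · rcases eq_or_ne j i with rfl | h
    · simpa using hf
    · simp only [Function.update_of_ne h]
      exact A.one_mem
  · ext z
    rw [Finset.prod_eq_single i]
    · simp
    · intro j _ h
      simp [h]
    · simp

/-- By independence the integral of a product over sites factorizes, so positivity need only be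
checked at one site. -/
theorem IsPositiveFamily.pi {ι E : Type*} [Fintype ι] [MeasurableSpace E] {μ : Measure E}
    [IsProbabilityMeasure μ] {A : Submonoid (E → ℝ)} (hA : IsPositiveFamily μ A) :
    IsPositiveFamily (Measure.pi fun _ : ι => μ) (piFamily ι A) where
  measurable := by
    rintro _ ⟨h, hh, rfl⟩
    exact Finset.measurable_prod _ fun i _ =>
      (hA.measurable _ (hh i)).comp (measurable_pi_apply i)
  bounded := by
    rintro _ ⟨h, hh, rfl⟩
    choose B hB using fun i => hA.bounded _ (hh i)
    refine ⟨∏ i, B i, ?_⟩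
    have : ∀ i, ∀ᵐ z ∂(Measure.pi fun _ : ι => μ), |h i (z i)| ≤ B i := fun i =>
      (measurePreserving_eval (fun _ : ι => μ) i).quasiMeasurePreserving.ae (hB i)
    filter_upwards [ae_all_iff.2 this] with z hz
    rw [Finset.abs_prod]
    exact Finset.prod_le_prod (fun i _ => abs_nonneg _) fun i _ => hz i
  integral_nonneg := by
    rintro _ ⟨h, hh, rfl⟩
    rw [integral_fintype_prod_eq_prod]
    exact Finset.prod_nonneg fun i _ => hA.integral_nonneg _ (hh i)

/-- The convex cone spanned by a family of functions, closed under essentially bounded pointwise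
limits. -/
inductive PosCone {E : Type*} [MeasurableSpace E] (μ : Measure E) (A : Submonoid (E → ℝ)) :
    (E → ℝ) → Prop
  | of (f : E → ℝ) : f ∈ A → PosCone μ A f
  | add (f g : E → ℝ) : PosCone μ A f → PosCone μ A g → PosCone μ A (fun x => f x + g x)
  | smul (c : ℝ) (f : E → ℝ) : 0 ≤ c → PosCone μ A f → PosCone μ A (fun x => c * f x)
  -- The bound uniform in `n` makes dominated convergence applicable, so nonnegative integrals
  -- survive. Limits are needed for exponentials.
  | lim (F : ℕ → E → ℝ) (f : E → ℝ) (B : ℝ) : (∀ n, PosCone μ A (F n)) →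
      (∀ n, ∀ᵐ x ∂μ, |F n x| ≤ B) → (∀ x, Tendsto (fun n => F n x) atTop (𝓝 (f x))) →
      PosCone μ A f

namespace PosCone

variable {E : Type*} [MeasurableSpace E] {μ : Measure E} {A : Submonoid (E → ℝ)} {f g : E → ℝ}

theorem const {c : ℝ} (hc : 0 ≤ c) : PosCone μ A (fun _ => c) := by
  simpa using smul c 1 hc (of 1 A.one_mem)

theorem measurable (hA : IsPositiveFamily μ A) (hf : PosCone μ A f) : Measurable f := by
  induction hf with
  | of f h => exact hA.measurable f h
  | add f g _ _ h1 h2 => exact h1.add h2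
  | smul c f _ _ h => exact h.const_mul c
  | lim F f B _ _ hl h => exact measurable_of_tendsto_metrizable h (tendsto_pi_nhds.2 hl)

theorem bounded (hA : IsPositiveFamily μ A) (hf : PosCone μ A f) :
    ∃ B, ∀ᵐ x ∂μ, |f x| ≤ B := by
  induction hf with
  | of f h => exact hA.bounded f h
  | add f g _ _ h1 h2 =>
    obtain ⟨B, hB⟩ := h1
    obtain ⟨D, hD⟩ := h2
    refine ⟨B + D, ?_⟩
    filter_upwards [hB, hD] with x h h'
    exact (abs_add_le _ _).trans (add_le_add h h')
  | smul c f hc _ h =>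
    obtain ⟨B, hB⟩ := h
    refine ⟨c * B, ?_⟩
    filter_upwards [hB] with x h
    rw [abs_mul, abs_of_nonneg hc]
    gcongr
  | lim F f B _ hB hl h =>
    refine ⟨B, ?_⟩
    filter_upwards [ae_all_iff.2 hB] with x hx
    exact le_of_tendsto (hl x).abs (Eventually.of_forall hx)

theorem integrable [IsFiniteMeasure μ] (hA : IsPositiveFamily μ A) (hf : PosCone μ A f) :
    Integrable f μ := by
  obtain ⟨B, hB⟩ := hf.bounded hA
  exact Integrable.of_bound (hf.measurable hA).aestronglyMeasurable B hB

theorem integral_nonneg [IsFiniteMeasure μ] (hA : IsPositiveFamily μ A) (hf : PosCone μ A f) :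
    0 ≤ ∫ x, f x ∂μ := by
  induction hf with
  | of f h => exact hA.integral_nonneg f h
  | add f g hf hg h1 h2 =>
    rw [integral_add (hf.integrable hA) (hg.integrable hA)]
    exact add_nonneg h1 h2
  | smul c f hc _ h =>
    rw [integral_const_mul]
    exact mul_nonneg hc h
  | lim F f B hF hB hl h =>
    exact ge_of_tendsto (tendsto_integral_of_dominated_convergence (fun _ => B)
      (fun n => ((hF n).measurable hA).aestronglyMeasurable) (integrable_const B) hB
      (Eventually.of_forall hl)) (Eventually.of_forall h)

/-- Induction on both factors reduces to generators, where `A` is multiplicative. In the limit cases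
the essential bound of the other factor supplies the uniform bound. -/
theorem mul (hA : IsPositiveFamily μ A) (hf : PosCone μ A f) (hg : PosCone μ A g) :
    PosCone μ A (fun x => f x * g x) := by
  induction hf with
  | of f h =>
    induction hg with
    | of g h' => exact of _ (A.mul_mem h h')
    | add g g' _ _ h1 h2 => simpa only [mul_add] using add _ _ h1 h2
    | smul c g hc _ h1 => simpa only [mul_left_comm] using smul c _ hc h1
    | lim G g B hG hB hl h1 =>
      obtain ⟨D, hD⟩ := hA.bounded f h
      refine lim _ _ (D * B) h1 (fun n => ?_) fun x => (hl x).const_mul (f x)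
      filter_upwards [hD, hB n] with x h2 h3
      rw [abs_mul]
      exact mul_le_mul h2 h3 (abs_nonneg _) ((abs_nonneg _).trans h2)
  | add f f' _ _ h1 h2 => simpa only [add_mul] using add _ _ h1 h2
  | smul c f hc _ h1 => simpa only [mul_assoc] using smul c _ hc h1
  | lim F f B hF hB hl h1 =>
    obtain ⟨D, hD⟩ := hg.bounded hA
    refine lim _ _ (B * D) h1 (fun n => ?_) fun x => (hl x).mul_const (g x)
    filter_upwards [hD, hB n] with x h2 h3
    rw [abs_mul]
    exact mul_le_mul h3 h2 (abs_nonneg _) ((abs_nonneg _).trans h3)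

theorem pow (hA : IsPositiveFamily μ A) (hf : PosCone μ A f) (n : ℕ) :
    PosCone μ A (fun x => f x ^ n) := by
  induction n with
  | zero => simpa using const zero_le_one
  | succ n ih => simpa only [pow_succ] using ih.mul hA hf

theorem sum {ι : Type*} (s : Finset ι) {F : ι → E → ℝ} (h : ∀ i ∈ s, PosCone μ A (F i)) :
    PosCone μ A (fun x => ∑ i ∈ s, F i x) := by
  classical
  induction s using Finset.induction_on with
  | empty => simpa using const le_rfl
  | insert i s hi ih =>
    simp only [Finset.sum_insert hi]
    exact add _ _ (h i (by simp)) (ih fun j hj => h j (by simp [hj]))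

end PosCone

theorem abs_sum_pow_div_factorial_le {x B : ℝ} (h : |x| ≤ B) (N : ℕ) :
    |∑ n ∈ Finset.range N, (n.factorial : ℝ)⁻¹ * x ^ n| ≤ Real.exp B := by
  refine (Finset.abs_sum_le_sum_abs _ _).trans (le_trans ?_ (Real.exp_le_exp.2 h))
  refine le_trans (le_of_eq ?_) (Real.sum_le_exp_of_nonneg (abs_nonneg x) N)
  refine Finset.sum_congr rfl fun n _ => ?_
  rw [abs_mul, abs_pow, abs_of_nonneg (by positivity), div_eq_inv_mul]

theorem tendsto_sum_pow_div_factorial (x : ℝ) :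
    Tendsto (fun N => ∑ n ∈ Finset.range N, (n.factorial : ℝ)⁻¹ * x ^ n) atTop
      (𝓝 (Real.exp x)) := by
  have := (NormedSpace.expSeries_div_hasSum_exp (𝔸 := ℝ) x).tendsto_sum_nat
  rw [← Real.exp_eq_exp_ℝ] at this
  simpa only [div_eq_inv_mul] using this

theorem PosCone.exp {E : Type*} [MeasurableSpace E] {μ : Measure E} {A : Submonoid (E → ℝ)}
    {f : E → ℝ} (hA : IsPositiveFamily μ A) (hf : PosCone μ A f) :
    PosCone μ A (fun x => Real.exp (f x)) := by
  obtain ⟨B, hB⟩ := hf.bounded hA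
  refine lim (fun N x => ∑ n ∈ Finset.range N, (n.factorial : ℝ)⁻¹ * f x ^ n) _ (Real.exp B)
    (fun N => PosCone.sum _ fun n _ => smul _ _ (by positivity) (hf.pow hA n)) (fun N => ?_)
    fun x => tendsto_sum_pow_div_factorial _
  filter_upwards [hB] with x hx
  exact abs_sum_pow_div_factorial_le hx N

/-! ### One-site parity families -/

/-- The functions `x ↦ x ^ a * k x` with `k` even and nonnegative. -/
def evenOddFamily (ν : Measure ℝ) : Submonoid (ℝ → ℝ) where
  carrier := {f | Measurable f ∧ (∃ B, ∀ᵐ x ∂ν, |f x| ≤ B) ∧ ∃ (a : ℕ) (k : ℝ → ℝ),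
    (∀ x, 0 ≤ k x) ∧ (∀ x, k (-x) = k x) ∧ ∀ x, f x = x ^ a * k x}
  one_mem' := ⟨measurable_const, ⟨1, by simp⟩, 0, 1, by simp, by simp, by simp⟩
  mul_mem' := by
    rintro f g ⟨hf, ⟨B, hB⟩, a, k, hk, hk', hfk⟩ ⟨hg, ⟨D, hD⟩, b, l, hl, hl', hgl⟩
    refine ⟨hf.mul hg, ⟨B * D, ?_⟩, a + b, k * l, fun x => mul_nonneg (hk x) (hl x),
      fun x => by simp [hk', hl'], fun x => by simp [hfk, hgl]; ring⟩
    filter_upwards [hB, hD] with x h1 h2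
    rw [Pi.mul_apply, abs_mul]
    exact mul_le_mul h1 h2 (abs_nonneg _) ((abs_nonneg _).trans h1)

/-- The functions `(x, y) ↦ (x + y) ^ a * (x - y) ^ b * k (x, y)` with `k` nonnegative and
invariant under exchange of the variables and under a global change of sign. -/
def pairFamily (ν : Measure ℝ) : Submonoid (ℝ × ℝ → ℝ) where
  carrier := {f | Measurable f ∧ (∃ B, ∀ᵐ x ∂(ν.prod ν), |f x| ≤ B) ∧
    ∃ (a b : ℕ) (k : ℝ × ℝ → ℝ), (∀ x, 0 ≤ k x) ∧ (∀ x, k (-x) = k x) ∧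
      (∀ x, k x.swap = k x) ∧ ∀ x, f x = (x.1 + x.2) ^ a * (x.1 - x.2) ^ b * k x}
  one_mem' := ⟨measurable_const, ⟨1, by simp⟩, 0, 0, 1, by simp, by simp, by simp, by simp⟩
  mul_mem' := by
    rintro f g ⟨hf, ⟨B, hB⟩, a, a', k, hk, hk', hk'', hfk⟩
      ⟨hg, ⟨D, hD⟩, b, b', l, hl, hl', hl'', hgl⟩
    refine ⟨hf.mul hg, ⟨B * D, ?_⟩, a + b, a' + b', k * l, fun x => mul_nonneg (hk x) (hl x),
      fun x => by simp [hk', hl'], fun x => by simp [hk'', hl''],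
      fun x => by simp [hfk, hgl]; ring⟩
    filter_upwards [hB, hD] with x h1 h2
    rw [Pi.mul_apply, abs_mul]
    exact mul_le_mul h1 h2 (abs_nonneg _) ((abs_nonneg _).trans h1)

theorem measurePreserving_neg_of_map_eq {ν : Measure ℝ} (hsymm : ν.map (fun y => -y) = ν) :
    MeasurePreserving (fun y : ℝ => -y) ν ν := ⟨measurable_neg, hsymm⟩

theorem integral_eq_zero_of_comp_eq_neg {E : Type*} [MeasurableSpace E] {μ : Measure E}
    {s : E → E} (hs : MeasurePreserving s μ μ) {f : E → ℝ} (hf : Measurable f)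
    (h : ∀ x, f (s x) = - f x) : ∫ x, f x ∂μ = 0 := by
  have h1 : ∫ x, f (s x) ∂μ = ∫ x, f x ∂μ := by
    rw [← integral_map hs.aemeasurable hf.aestronglyMeasurable, hs.map_eq]
  simp only [h, integral_neg] at h1
  linarith

theorem isPositiveFamily_evenOddFamily {ν : Measure ℝ} (hsymm : ν.map (fun y => -y) = ν) :
    IsPositiveFamily ν (evenOddFamily ν) where
  measurable f h := h.1
  bounded f h := h.2.1
  integral_nonneg := by
    rintro f ⟨hf, _, a, k, hk, hk', h⟩
    rcases Nat.even_or_odd a with ha | ha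
    · exact integral_nonneg fun x => by
        rw [h]
        exact mul_nonneg (ha.pow_nonneg x) (hk x)
    · exact (integral_eq_zero_of_comp_eq_neg (measurePreserving_neg_of_map_eq hsymm) hf
        fun x => by rw [h, h, hk', ha.neg_pow, neg_mul]).ge

/-- With both exponents even the integrand is nonnegative. If `b` is odd, exchanging the variables
flips its sign; if only `a` is odd, the global sign change does. In both cases the integral
vanishes. -/
theorem isPositiveFamily_pairFamily {ν : Measure ℝ} [IsProbabilityMeasure ν]
    (hsymm : ν.map (fun y => -y) = ν) : IsPositiveFamily (ν.prod ν) (pairFamily ν) where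
  measurable f h := h.1
  bounded f h := h.2.1
  integral_nonneg := by
    rintro f ⟨hf, _, a, b, k, hk, hk', hk'', h⟩
    have hneg := measurePreserving_neg_of_map_eq hsymm
    rcases Nat.even_or_odd b with hb | hb
    · rcases Nat.even_or_odd a with ha | ha
      · exact integral_nonneg fun x => by
          rw [h]
          exact mul_nonneg (mul_nonneg (ha.pow_nonneg _) (hb.pow_nonneg _)) (hk x)
      · refine (integral_eq_zero_of_comp_eq_neg (hneg.prod hneg) hf fun x => ?_).ge
        have e1 : (-x.1 + -x.2) ^ a = -(x.1 + x.2) ^ a := by rw [← ha.neg_pow]; ring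
        have e2 : (-x.1 - -x.2) ^ b = (x.1 - x.2) ^ b := by rw [← hb.neg_pow]; ring
        have e3 : k (Prod.map (fun y => -y) (fun y => -y) x) = k x := hk' x
        rw [h, h, e3]
        simp only [Prod.map_fst, Prod.map_snd, e1, e2]
        ring
    · refine (integral_eq_zero_of_comp_eq_neg
        (Measure.measurePreserving_swap (μ := ν) (ν := ν)) hf fun x => ?_).ge
      have e2 : (x.2 - x.1) ^ b = -(x.1 - x.2) ^ b := by rw [← hb.neg_pow]; ring
      rw [h, h, hk'']
      simp only [Prod.fst_swap, Prod.snd_swap, e2, add_comm x.2]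
      ring

/-! ### Duplicated configurations and the Griffiths inequality -/

/-- The law of a configuration of independent variables with law `ν`. -/
abbrev configLaw (κ ι : Type*) [Fintype κ] [Fintype ι] (ν : Measure ℝ) : Measure (κ → ι → ℝ) :=
  Measure.pi fun _ => Measure.pi fun _ => ν

/-- The law of a pair of independent configurations, stored site by site. -/
abbrev pairConfigLaw (κ ι : Type*) [Fintype κ] [Fintype ι] (ν : Measure ℝ) :
    Measure (κ → ι → ℝ × ℝ) :=
  Measure.pi fun _ => Measure.pi fun _ => ν.prod ν

/-- The first configuration of a pair. -/
def leftConfig {κ ι : Type*} (z : κ → ι → ℝ × ℝ) : κ → ι → ℝ := fun k p => (z k p).1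

/-- The second configuration of a pair. -/
def rightConfig {κ ι : Type*} (z : κ → ι → ℝ × ℝ) : κ → ι → ℝ := fun k p => (z k p).2

abbrev configFamily (κ ι : Type*) [Fintype κ] [Fintype ι] (ν : Measure ℝ) :
    Submonoid ((κ → ι → ℝ) → ℝ) :=
  piFamily κ (piFamily ι (evenOddFamily ν))

abbrev pairConfigFamily (κ ι : Type*) [Fintype κ] [Fintype ι] (ν : Measure ℝ) :
    Submonoid ((κ → ι → ℝ × ℝ) → ℝ) :=
  piFamily κ (piFamily ι (pairFamily ν))

/-- The cone of functions to which the Griffiths inequalities apply: nonnegative combinations,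
products and limits of monotone odd functions of the single variables. -/
structure Ferro {κ ι : Type*} [Fintype κ] [Fintype ι] (ν : Measure ℝ)
    (F : (κ → ι → ℝ) → ℝ) : Prop where
  pos : PosCone (configLaw κ ι ν) (configFamily κ ι ν) F
  add_pair : PosCone (pairConfigLaw κ ι ν) (pairConfigFamily κ ι ν)
    fun z => F (leftConfig z) + F (rightConfig z)
  sub_pair : PosCone (pairConfigLaw κ ι ν) (pairConfigFamily κ ι ν)
    fun z => F (leftConfig z) - F (rightConfig z)

section Pair

variable {κ ι : Type*} [Fintype κ] [Fintype ι] {ν : Measure ℝ} [IsProbabilityMeasure ν]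

theorem measurePreserving_leftConfig :
    MeasurePreserving leftConfig (pairConfigLaw κ ι ν) (configLaw κ ι ν) :=
  measurePreserving_pi _ _ fun _ => measurePreserving_pi _ _ fun _ => measurePreserving_fst

theorem measurePreserving_rightConfig :
    MeasurePreserving rightConfig (pairConfigLaw κ ι ν) (configLaw κ ι ν) :=
  measurePreserving_pi _ _ fun _ => measurePreserving_pi _ _ fun _ => measurePreserving_snd

theorem measurePreserving_pairConfig :
    MeasurePreserving (fun z => (leftConfig z, rightConfig z)) (pairConfigLaw κ ι ν)
      ((configLaw κ ι ν).prod (configLaw κ ι ν)) :=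
  (measurePreserving_arrowProdEquivProdArrow (ι → ℝ) (ι → ℝ) κ (fun _ => Measure.pi fun _ => ν)
    fun _ => Measure.pi fun _ => ν).comp
    (measurePreserving_pi _ _ fun _ =>
      measurePreserving_arrowProdEquivProdArrow ℝ ℝ ι (fun _ => ν) fun _ => ν)

theorem integral_pairConfig_mul {f g : (κ → ι → ℝ) → ℝ} (hf : Measurable f) (hg : Measurable g) :
    ∫ z, f (leftConfig z) * g (rightConfig z) ∂(pairConfigLaw κ ι ν) =
      (∫ x, f x ∂(configLaw κ ι ν)) * ∫ x, g x ∂(configLaw κ ι ν) := by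
  rw [← integral_prod_mul, ← (measurePreserving_pairConfig (κ := κ) (ι := ι) (ν := ν)).map_eq,
    integral_map measurePreserving_pairConfig.aemeasurable]
  exact ((hf.comp measurable_fst).mul (hg.comp measurable_snd)).aestronglyMeasurable

end Pair

namespace Ferro

variable {κ ι : Type*} [Fintype κ] [Fintype ι] {ν : Measure ℝ} {F G : (κ → ι → ℝ) → ℝ}

theorem const {c : ℝ} (hc : 0 ≤ c) : Ferro ν (fun _ : κ → ι → ℝ => c) where
  pos := PosCone.const hc
  add_pair := PosCone.const (add_nonneg hc hc)
  sub_pair := by simpa using PosCone.const le_rfl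

theorem add (hF : Ferro ν F) (hG : Ferro ν G) : Ferro ν (fun x => F x + G x) where
  pos := hF.pos.add _ _ hG.pos
  add_pair := by
    simpa only [add_add_add_comm] using hF.add_pair.add _ _ hG.add_pair
  sub_pair := by
    simpa only [add_sub_add_comm] using hF.sub_pair.add _ _ hG.sub_pair

theorem sum {σ : Type*} (s : Finset σ) {F : σ → (κ → ι → ℝ) → ℝ} (h : ∀ i ∈ s, Ferro ν (F i)) :
    Ferro ν (fun x => ∑ i ∈ s, F i x) := by
  classical
  induction s using Finset.induction_on with
  | empty => simpa using const le_rfl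
  | insert i s hi ih =>
    simp only [Finset.sum_insert hi]
    exact add (h i (by simp)) (ih fun j hj => h j (by simp [hj]))

theorem smul {c : ℝ} (hc : 0 ≤ c) (hF : Ferro ν F) : Ferro ν (fun x => c * F x) where
  pos := hF.pos.smul c _ hc
  add_pair := by simpa only [mul_add] using hF.add_pair.smul c _ hc
  sub_pair := by simpa only [mul_sub] using hF.sub_pair.smul c _ hc

/-- Monotone odd functions of a single variable are in the cone. -/
theorem of_odd_monotone {g : ℝ → ℝ} (hbdd : ∃ B, ∀ᵐ x ∂ν, |g x| ≤ B)
    (hodd : ∀ x, g (-x) = - g x) (hmono : Monotone g) (k : κ) (p : ι) :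
    Ferro ν (fun x : κ → ι → ℝ => g (x k p)) := by
  have hm : Measurable g := hmono.measurable
  have h0 : g 0 = 0 := by
    have := hodd 0
    simp only [neg_zero] at this
    linarith
  obtain ⟨B, hB⟩ := hbdd
  have hB1 : ∀ᵐ z ∂(ν.prod ν), |g z.1| ≤ B :=
    Measure.quasiMeasurePreserving_fst.ae hB
  have hB2 : ∀ᵐ z ∂(ν.prod ν), |g z.2| ≤ B :=
    Measure.quasiMeasurePreserving_snd.ae hB
  refine ⟨.of _ (comp_eval_mem_piFamily (comp_eval_mem_piFamily (f := g) ?_ p) k),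
    .of _ (comp_eval_mem_piFamily (comp_eval_mem_piFamily
      (f := fun w : ℝ × ℝ => g w.1 + g w.2) ?_ p) k),
    .of _ (comp_eval_mem_piFamily (comp_eval_mem_piFamily
      (f := fun w : ℝ × ℝ => g w.1 - g w.2) ?_ p) k)⟩
  -- The even factor is the quotient `g x / x`, nonnegative by monotonicity and oddness. Division by
  -- zero is harmless because the numerator vanishes there too; the same device handles the sum and
  -- the difference below.
  · refine ⟨hm, ⟨B, hB⟩, 1, fun x => g x / x, fun x => ?_, fun x => ?_, fun x => ?_⟩
    · rcases le_total 0 x with h | h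
      · exact div_nonneg (h0 ▸ hmono h) h
      · exact div_nonneg_of_nonpos (h0 ▸ hmono h) h
    · simp only [hodd, neg_div_neg_eq]
    · rcases eq_or_ne x 0 with rfl | h
      · simp [h0]
      · field_simp
  · refine ⟨(hm.comp measurable_fst).add (hm.comp measurable_snd), ⟨B + B, ?_⟩, 1, 0,
      fun w => (g w.1 + g w.2) / (w.1 + w.2), fun x => ?_, fun x => ?_, fun x => ?_, fun x => ?_⟩
    · filter_upwards [hB1, hB2] with z h1 h2
      exact (abs_add_le _ _).trans (add_le_add h1 h2)
    · rcases le_total 0 (x.1 + x.2) with h | h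
      · have := hmono (show -x.2 ≤ x.1 by linarith)
        rw [hodd] at this
        exact div_nonneg (by linarith) h
      · have := hmono (show x.1 ≤ -x.2 by linarith)
        rw [hodd] at this
        exact div_nonneg_of_nonpos (by linarith) h
    · dsimp only
      rw [Prod.fst_neg, Prod.snd_neg, hodd, hodd, ← neg_add, ← neg_add, neg_div_neg_eq]
    · simp only [Prod.fst_swap, Prod.snd_swap, add_comm]
    · rcases eq_or_ne (x.1 + x.2) 0 with h | h
      · have : x.1 = -x.2 := by linarith
        simp [this, hodd]
      · field_simp
  · refine ⟨(hm.comp measurable_fst).sub (hm.comp measurable_snd), ⟨B + B, ?_⟩, 0, 1,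
      fun w => (g w.1 - g w.2) / (w.1 - w.2), fun x => ?_, fun x => ?_, fun x => ?_, fun x => ?_⟩
    · filter_upwards [hB1, hB2] with z h1 h2
      exact (abs_sub _ _).trans (add_le_add h1 h2)
    · rcases le_total x.2 x.1 with h | h
      · exact div_nonneg (sub_nonneg.2 (hmono h)) (sub_nonneg.2 h)
      · exact div_nonneg_of_nonpos (sub_nonpos.2 (hmono h)) (sub_nonpos.2 h)
    · dsimp only
      rw [Prod.fst_neg, Prod.snd_neg, hodd, hodd, ← neg_div_neg_eq]
      congr 1 <;> ring
    · dsimp only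
      rw [Prod.fst_swap, Prod.snd_swap, ← neg_div_neg_eq, neg_sub, neg_sub]
    · rcases eq_or_ne (x.1 - x.2) 0 with h | h
      · have : x.1 = x.2 := by linarith
        simp [this]
      · field_simp

end Ferro

section Family

variable {κ ι : Type*} [Fintype κ] [Fintype ι] {ν : Measure ℝ} [IsProbabilityMeasure ν]

theorem isPositiveFamily_configFamily (hsymm : ν.map (fun y => -y) = ν) :
    IsPositiveFamily (configLaw κ ι ν) (configFamily κ ι ν) :=
  (isPositiveFamily_evenOddFamily hsymm).pi.pi

theorem isPositiveFamily_pairConfigFamily (hsymm : ν.map (fun y => -y) = ν) :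
    IsPositiveFamily (pairConfigLaw κ ι ν) (pairConfigFamily κ ι ν) :=
  (isPositiveFamily_pairFamily hsymm).pi.pi

end Family

namespace Ferro

variable {κ ι : Type*} [Fintype κ] [Fintype ι] {ν : Measure ℝ} {F G : (κ → ι → ℝ) → ℝ}
  [IsProbabilityMeasure ν]

theorem measurable (hsymm : ν.map (fun y => -y) = ν) (hF : Ferro ν F) : Measurable F :=
  hF.pos.measurable (isPositiveFamily_configFamily hsymm)

theorem bounded (hsymm : ν.map (fun y => -y) = ν) (hF : Ferro ν F) :
    ∃ B, ∀ᵐ x ∂(configLaw κ ι ν), |F x| ≤ B :=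
  hF.pos.bounded (isPositiveFamily_configFamily hsymm)

theorem integrable (hsymm : ν.map (fun y => -y) = ν) (hF : Ferro ν F) :
    Integrable F (configLaw κ ι ν) :=
  hF.pos.integrable (isPositiveFamily_configFamily hsymm)

/-- With primes for the second copy, $FG\pm F'G'=\tfrac12[(F+F')(G\pm G')+(F-F')(G\mp G')]$. -/
theorem mul (hsymm : ν.map (fun y => -y) = ν) (hF : Ferro ν F) (hG : Ferro ν G) :
    Ferro ν (fun x => F x * G x) := by
  have hA := isPositiveFamily_pairConfigFamily (κ := κ) (ι := ι) hsymm
  have h2 : (0 : ℝ) ≤ 1 / 2 := by norm_num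
  refine ⟨hF.pos.mul (isPositiveFamily_configFamily hsymm) hG.pos, ?_, ?_⟩
  · convert ((hF.add_pair.mul hA hG.add_pair).add _ _ (hF.sub_pair.mul hA hG.sub_pair)).smul
      (1 / 2) _ h2 using 2
    ring
  · convert ((hF.add_pair.mul hA hG.sub_pair).add _ _ (hF.sub_pair.mul hA hG.add_pair)).smul
      (1 / 2) _ h2 using 2
    ring

theorem pow (hsymm : ν.map (fun y => -y) = ν) (hF : Ferro ν F) (n : ℕ) :
    Ferro ν (fun x => F x ^ n) := by
  induction n with
  | zero => simpa using const zero_le_one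
  | succ n ih => simpa only [pow_succ] using ih.mul hsymm hF

theorem lim {S : ℕ → (κ → ι → ℝ) → ℝ} {B : ℝ} (hS : ∀ n, Ferro ν (S n))
    (hB : ∀ n, ∀ᵐ x ∂(configLaw κ ι ν), |S n x| ≤ B)
    (hl : ∀ x, Tendsto (fun n => S n x) atTop (𝓝 (F x))) : Ferro ν F := by
  have hB1 : ∀ n, ∀ᵐ z ∂(pairConfigLaw κ ι ν), |S n (leftConfig z)| ≤ B := fun n =>
    measurePreserving_leftConfig.quasiMeasurePreserving.ae (hB n)
  have hB2 : ∀ n, ∀ᵐ z ∂(pairConfigLaw κ ι ν), |S n (rightConfig z)| ≤ B := fun n =>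
    measurePreserving_rightConfig.quasiMeasurePreserving.ae (hB n)
  refine ⟨.lim S F B (fun n => (hS n).pos) hB hl,
    .lim _ _ (B + B) (fun n => (hS n).add_pair) (fun n => ?_) fun x => (hl _).add (hl _),
    .lim _ _ (B + B) (fun n => (hS n).sub_pair) (fun n => ?_) fun x => (hl _).sub (hl _)⟩
  · filter_upwards [hB1 n, hB2 n] with z h1 h2
    exact (abs_add_le _ _).trans (add_le_add h1 h2)
  · filter_upwards [hB1 n, hB2 n] with z h1 h2
    exact (abs_sub _ _).trans (add_le_add h1 h2)

theorem exp (hsymm : ν.map (fun y => -y) = ν) (hF : Ferro ν F) :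
    Ferro ν (fun x => Real.exp (F x)) := by
  obtain ⟨B, hB⟩ := hF.bounded hsymm
  refine lim (S := fun N x => ∑ n ∈ Finset.range N, (n.factorial : ℝ)⁻¹ * F x ^ n)
    (B := Real.exp B) (fun N => sum _ fun n _ => smul (by positivity) (hF.pow hsymm n))
    (fun N => ?_) fun x => tendsto_sum_pow_div_factorial _
  filter_upwards [hB] with x hx
  exact abs_sum_pow_div_factorial_le hx N

/-- The Griffiths inequality `⟨F G⟩ ⟨1⟩ ≥ ⟨F⟩ ⟨G⟩` for the weight `exp H`. -/
theorem integral_mul_integral_le (hsymm : ν.map (fun y => -y) = ν) {H : (κ → ι → ℝ) → ℝ}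
    (hF : Ferro ν F) (hG : Ferro ν G) (hH : Ferro ν H) :
    (∫ x, F x * Real.exp (H x) ∂(configLaw κ ι ν)) *
        (∫ x, G x * Real.exp (H x) ∂(configLaw κ ι ν)) ≤
      (∫ x, F x * G x * Real.exp (H x) ∂(configLaw κ ι ν)) *
        ∫ x, Real.exp (H x) ∂(configLaw κ ι ν) := by
  have hA := isPositiveFamily_pairConfigFamily (κ := κ) (ι := ι) hsymm
  have hE := hH.exp hsymm
  have hFE := hF.mul hsymm hE
  have hGE := hG.mul hsymm hE
  have hFGE := (hF.mul hsymm hG).mul hsymm hE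
  -- Ginibre's argument: the doubled integral of $(F-F')(G-G')e^{H+H'}$ is nonnegative, and by
  -- independence of the copies it is twice the difference of the two sides.
  have key := ((hF.sub_pair.mul hA hG.sub_pair).mul hA (hH.add_pair.exp hA)).integral_nonneg hA
  have hint : ∀ {f g : (κ → ι → ℝ) → ℝ}, Ferro ν f → Ferro ν g →
      Integrable (fun z => f (leftConfig z) * g (rightConfig z)) (pairConfigLaw κ ι ν) := by
    intro f g hf hg
    have := (hf.integrable hsymm).mul_prod (hg.integrable hsymm)
    rw [← (measurePreserving_pairConfig (κ := κ) (ι := ι) (ν := ν)).map_eq] at this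
    exact this.comp_measurable (measurePreserving_pairConfig (ν := ν)).measurable
  have e : ∀ z : κ → ι → ℝ × ℝ,
      (F (leftConfig z) - F (rightConfig z)) * (G (leftConfig z) - G (rightConfig z)) *
        Real.exp (H (leftConfig z) + H (rightConfig z)) =
      (F (leftConfig z) * G (leftConfig z) * Real.exp (H (leftConfig z))) *
          Real.exp (H (rightConfig z)) +
        Real.exp (H (leftConfig z)) *
          (F (rightConfig z) * G (rightConfig z) * Real.exp (H (rightConfig z))) -
        ((F (leftConfig z) * Real.exp (H (leftConfig z))) *
          (G (rightConfig z) * Real.exp (H (rightConfig z))) +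
        (G (leftConfig z) * Real.exp (H (leftConfig z))) *
          (F (rightConfig z) * Real.exp (H (rightConfig z)))) := by
    intro z
    rw [Real.exp_add]
    ring
  simp only [e] at key
  have hsub : ∀ {a b c d : (κ → ι → ℝ × ℝ) → ℝ}, Integrable a (pairConfigLaw κ ι ν) →
      Integrable b (pairConfigLaw κ ι ν) → Integrable c (pairConfigLaw κ ι ν) →
      Integrable d (pairConfigLaw κ ι ν) →
      ∫ z, (a z + b z - (c z + d z)) ∂(pairConfigLaw κ ι ν) =
        ∫ z, (a z + b z) ∂(pairConfigLaw κ ι ν) - ∫ z, (c z + d z) ∂(pairConfigLaw κ ι ν) :=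
    fun ha hb hc hd => integral_sub (ha.add hb) (hc.add hd)
  rw [hsub (hint hFGE hE) (hint hE hFGE) (hint hFE hGE) (hint hGE hFE),
    integral_add (hint hFGE hE) (hint hE hFGE), integral_add (hint hFE hGE) (hint hGE hFE),
    integral_pairConfig_mul (hFGE.measurable hsymm) (hE.measurable hsymm),
    integral_pairConfig_mul (hE.measurable hsymm) (hFGE.measurable hsymm),
    integral_pairConfig_mul (hFE.measurable hsymm) (hGE.measurable hsymm),
    integral_pairConfig_mul (hGE.measurable hsymm) (hFE.measurable hsymm)] at key
  linarith

end Ferro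

/-! ### Gibbs expectations and odd step functions -/

/-- The expectation of `f` under the reweighting of the product measure by `exp H`. -/
def gibbs {κ ι : Type*} [Fintype κ] [Fintype ι] (ν : Measure ℝ) (H f : (κ → ι → ℝ) → ℝ) : ℝ :=
  (∫ x, f x * Real.exp (H x) ∂(configLaw κ ι ν)) / ∫ x, Real.exp (H x) ∂(configLaw κ ι ν)

/-- The odd step function `𝟙 {r ≤ x} - 𝟙 {x ≤ -r}`. -/
def stepSign (r x : ℝ) : ℝ := if r ≤ x then 1 else if x ≤ -r then -1 else 0

section StepSign

variable {r : ℝ}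

theorem stepSign_neg (hr : 0 < r) (x : ℝ) : stepSign r (-x) = -stepSign r x := by
  unfold stepSign
  split_ifs <;> first | (exfalso; linarith) | norm_num

theorem stepSign_monotone (r : ℝ) : Monotone (stepSign r) := by
  intro x y h
  unfold stepSign
  split_ifs <;> first | (exfalso; linarith) | norm_num

theorem abs_stepSign_le_one (r x : ℝ) : |stepSign r x| ≤ 1 := by
  unfold stepSign
  split_ifs <;> norm_num

/-- Unless both variables exceed `r` in modulus with equal signs, one is below `r` and one is above
`-r`, while the other is at most `R` in modulus. -/
theorem one_sub_stepSign_mul_le {x y R : ℝ} (hr : 0 < r) (hrR : r ≤ R) (hx : |x| ≤ R)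
    (hy : |y| ≤ R) :
    1 - stepSign r x * stepSign r y = 0 ∨
      (1 - stepSign r x * stepSign r y ≤ 2 ∧ |x + y| ≤ R + r) := by
  rw [abs_le] at hx hy
  rw [abs_le]
  unfold stepSign
  split_ifs <;> first
    | (left; norm_num; done)
    | (right; refine ⟨by norm_num, ?_, ?_⟩ <;> linarith)

/-- The expression is twice the indicator that the two signs agree and are nonzero, written as a sum
of functions in the cone. -/
theorem stepSign_mul_add_sq_le {x y : ℝ} :
    stepSign r x * stepSign r y + stepSign r x ^ 2 * stepSign r y ^ 2 = 0 ∨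
      (stepSign r x * stepSign r y + stepSign r x ^ 2 * stepSign r y ^ 2 = 2 ∧
        2 * r ≤ |x + y|) := by
  rw [le_abs]
  unfold stepSign
  split_ifs <;> first
    | (left; norm_num; done)
    | (right; refine ⟨by norm_num, ?_⟩; first | (left; linarith) | (right; linarith))

theorem sub_stepSign_mem_evenOddFamily {ν : Measure ℝ} {R : ℝ} (hR : ∀ᵐ x ∂ν, |x| ≤ R)
    (hr : 0 < r) : (fun x => x - r * stepSign r x) ∈ evenOddFamily ν := by
  refine ⟨measurable_id.sub ((stepSign_monotone r).measurable.const_mul r), ⟨R + r, ?_⟩, 1,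
    fun x => (x - r * stepSign r x) / x, fun x => ?_, fun x => ?_, fun x => ?_⟩
  · filter_upwards [hR] with x hx
    refine (abs_sub _ _).trans (add_le_add hx ?_)
    rw [abs_mul, abs_of_pos hr]
    exact mul_le_of_le_one_right hr.le (abs_stepSign_le_one r x)
  · rcases le_total 0 x with h | h
    · refine div_nonneg ?_ h
      unfold stepSign
      split_ifs <;> linarith
    · refine div_nonneg_of_nonpos ?_ h
      unfold stepSign
      split_ifs <;> linarith
  · simp only [stepSign_neg hr]
    rw [mul_neg, ← neg_sub', neg_div_neg_eq]
  · rcases eq_or_ne x 0 with rfl | h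
    · have : stepSign r 0 = 0 := by
        unfold stepSign
        split_ifs <;> first | (exfalso; linarith) | norm_num
      simp [this]
    · field_simp

theorem one_sub_stepSign_sq_mem_evenOddFamily (ν : Measure ℝ) (hr : 0 < r) :
    (fun x => 1 - stepSign r x ^ 2) ∈ evenOddFamily ν := by
  have h : ∀ x, 0 ≤ 1 - stepSign r x ^ 2 ∧ 1 - stepSign r x ^ 2 ≤ 1 := fun x =>
    ⟨sub_nonneg.2 ((sq_le_one_iff_abs_le_one _).2 (abs_stepSign_le_one r x)),
      sub_le_self _ (sq_nonneg _)⟩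
  refine ⟨measurable_const.sub ((stepSign_monotone r).measurable.pow_const 2),
    ⟨1, .of_forall fun x => ?_⟩, 0, fun x => 1 - stepSign r x ^ 2, fun x => (h x).1,
    fun x => ?_, fun x => ?_⟩
  · rw [abs_of_nonneg (h x).1]
    exact (h x).2
  · simp only [stepSign_neg hr, neg_sq]
  · simp

end StepSign

/-! ### Correlation inequalities -/

section Gibbs

variable {κ ι : Type*} [Fintype κ] [Fintype ι] {ν : Measure ℝ} {F G H : (κ → ι → ℝ) → ℝ}

theorem PosCone.of_site {g : ℝ → ℝ} (hg : g ∈ evenOddFamily ν) (k : κ) (p : ι) :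
    PosCone (configLaw κ ι ν) (configFamily κ ι ν) fun x => g (x k p) :=
  .of _ (comp_eval_mem_piFamily (comp_eval_mem_piFamily hg p) k)

theorem Ferro.stepSign {r : ℝ} (hr : 0 < r) (k : κ) (p : ι) :
    Ferro ν fun x : κ → ι → ℝ => stepSign r (x k p) :=
  .of_odd_monotone ⟨1, .of_forall (abs_stepSign_le_one r)⟩ (stepSign_neg hr)
    (stepSign_monotone r) k p

theorem Ferro.coord {R : ℝ} (hR : ∀ᵐ x ∂ν, |x| ≤ R) (k : κ) (p : ι) :
    Ferro ν fun x : κ → ι → ℝ => x k p :=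
  .of_odd_monotone (g := fun x => x) ⟨R, hR⟩ (fun _ => rfl) monotone_id k p

theorem gibbs_const_mul (c : ℝ) : gibbs ν H (fun x => c * F x) = c * gibbs ν H F := by
  simp only [gibbs, mul_assoc, integral_const_mul, mul_div_assoc]

variable [IsProbabilityMeasure ν]

theorem Ferro.integral_exp_pos (hsymm : ν.map (fun y => -y) = ν) (hH : Ferro ν H) :
    0 < ∫ x, Real.exp (H x) ∂(configLaw κ ι ν) :=
  MeasureTheory.integral_exp_pos ((hH.exp hsymm).integrable hsymm)

theorem gibbs_mul_le (hsymm : ν.map (fun y => -y) = ν) (hF : Ferro ν F) (hG : Ferro ν G)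
    (hH : Ferro ν H) : gibbs ν H F * gibbs ν H G ≤ gibbs ν H fun x => F x * G x := by
  have hZ := hH.integral_exp_pos hsymm
  unfold gibbs
  rw [div_mul_div_comm, div_le_div_iff₀ (by positivity) hZ, ← mul_assoc]
  exact mul_le_mul_of_nonneg_right (hF.integral_mul_integral_le hsymm hG hH) hZ.le

/-- This is the Griffiths inequality for `F` and `exp G` under the weight `exp H`. -/
theorem gibbs_le_gibbs_add (hsymm : ν.map (fun y => -y) = ν) (hF : Ferro ν F) (hG : Ferro ν G)
    (hH : Ferro ν H) : gibbs ν H F ≤ gibbs ν (fun x => H x + G x) F := by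
  have hZ := hH.integral_exp_pos hsymm
  have hZ' := (hH.add hG).integral_exp_pos hsymm
  have key := hF.integral_mul_integral_le hsymm (hG.exp hsymm) hH
  unfold gibbs
  rw [div_le_div_iff₀ hZ hZ']
  simp only [Real.exp_add, mul_assoc, mul_comm (Real.exp (H _)) (Real.exp (G _))] at key ⊢
  exact key

theorem gibbs_nonneg (hsymm : ν.map (fun y => -y) = ν)
    (hF : PosCone (configLaw κ ι ν) (configFamily κ ι ν) F) (hH : Ferro ν H) :
    0 ≤ gibbs ν H F :=
  have hA := isPositiveFamily_configFamily (κ := κ) (ι := ι) hsymm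
  div_nonneg ((hF.mul hA (hH.exp hsymm).pos).integral_nonneg hA) (hH.integral_exp_pos hsymm).le

theorem gibbs_add (hsymm : ν.map (fun y => -y) = ν)
    (hF : PosCone (configLaw κ ι ν) (configFamily κ ι ν) F)
    (hG : PosCone (configLaw κ ι ν) (configFamily κ ι ν) G) (hH : Ferro ν H) :
    gibbs ν H (fun x => F x + G x) = gibbs ν H F + gibbs ν H G := by
  have hA := isPositiveFamily_configFamily (κ := κ) (ι := ι) hsymm
  have hE := (hH.exp hsymm).pos
  unfold gibbs
  rw [← add_div, ← integral_add ((hF.mul hA hE).integrable hA) ((hG.mul hA hE).integrable hA)]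
  simp only [add_mul]

theorem gibbs_sum (hsymm : ν.map (fun y => -y) = ν) {σ : Type*} (s : Finset σ)
    {F : σ → (κ → ι → ℝ) → ℝ}
    (hF : ∀ i ∈ s, PosCone (configLaw κ ι ν) (configFamily κ ι ν) (F i)) (hH : Ferro ν H) :
    gibbs ν H (fun x => ∑ i ∈ s, F i x) = ∑ i ∈ s, gibbs ν H (F i) := by
  have hA := isPositiveFamily_configFamily (κ := κ) (ι := ι) hsymm
  unfold gibbs
  rw [← Finset.sum_div, ← integral_finsetSum s fun i hi =>
    ((hF i hi).mul hA (hH.exp hsymm).pos).integrable hA]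
  simp only [Finset.sum_mul]

/-- Only membership of the difference in the positive cone is required, not `Ferro`; this admits
factors such as `1 - stepSign r x ^ 2`, which decreases in `|x|`. -/
theorem gibbs_le_gibbs_of_posCone_sub (hsymm : ν.map (fun y => -y) = ν)
    (hF : PosCone (configLaw κ ι ν) (configFamily κ ι ν) F)
    (hFG : PosCone (configLaw κ ι ν) (configFamily κ ι ν) fun x => G x - F x)
    (hH : Ferro ν H) : gibbs ν H F ≤ gibbs ν H G := by
  have h := gibbs_add hsymm hF hFG hH
  simp only [add_sub_cancel] at h
  rw [h]
  exact le_add_of_nonneg_right (gibbs_nonneg hsymm hFG hH)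

theorem gibbs_zero : gibbs ν (fun _ => 0) F = ∫ x, F x ∂(configLaw κ ι ν) := by
  simp [gibbs]

theorem integral_config_site {g : ℝ → ℝ} (hg : Measurable g) (k : κ) (p : ι) :
    ∫ x, g (x k p) ∂(configLaw κ ι ν) = ∫ y, g y ∂ν := by
  have h : MeasurePreserving (fun x : κ → ι → ℝ => x k p) (configLaw κ ι ν) ν :=
    (measurePreserving_eval (fun _ : ι => ν) p).comp
      (measurePreserving_eval (fun _ : κ => Measure.pi fun _ : ι => ν) k)
  rw [← integral_map h.aemeasurable hg.aestronglyMeasurable, h.map_eq]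

theorem ae_config_site {P : ℝ → Prop} (h : ∀ᵐ y ∂ν, P y) (k : κ) (p : ι) :
    ∀ᵐ x ∂(configLaw κ ι ν), P (x k p) :=
  (measurePreserving_eval (fun _ : κ => Measure.pi fun _ : ι => ν) k).quasiMeasurePreserving.ae
    ((measurePreserving_eval (fun _ : ι => ν) p).quasiMeasurePreserving.ae h)

theorem sq_gibbs_stepSign (hsymm : ν.map (fun y => -y) = ν) (hH : Ferro ν H) {r : ℝ}
    (hr : 0 < r) (k : κ) (p : ι) :
    ∫ y, stepSign r y ^ 2 ∂ν ≤ gibbs ν H fun x => stepSign r (x k p) ^ 2 := by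
  have h := gibbs_le_gibbs_add hsymm ((Ferro.stepSign hr k p).pow hsymm 2) hH
    (.const (c := 0) le_rfl)
  rw [gibbs_zero, integral_config_site ((stepSign_monotone r).measurable.pow_const 2)] at h
  simpa only [zero_add] using h

/-- The Griffiths inequality yields $\langle s_js_k^2s_l\rangle$, and the middle square can be
dropped because $s_js_l(1-s_k^2)$ is in the positive cone. -/
theorem gibbs_stepSign_mul_trans (hsymm : ν.map (fun y => -y) = ν) (hH : Ferro ν H) {r : ℝ}
    (hr : 0 < r) (j k l : κ) (p : ι) :
    (gibbs ν H fun x => stepSign r (x j p) * stepSign r (x k p)) *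
        (gibbs ν H fun x => stepSign r (x k p) * stepSign r (x l p)) ≤
      gibbs ν H fun x => stepSign r (x j p) * stepSign r (x l p) := by
  have hA := isPositiveFamily_configFamily (κ := κ) (ι := ι) hsymm
  have hs := fun m => Ferro.stepSign (κ := κ) (ν := ν) hr m p
  have hjk := (hs j).mul hsymm (hs k)
  have hkl := (hs k).mul hsymm (hs l)
  refine (gibbs_mul_le hsymm hjk hkl hH).trans
    (gibbs_le_gibbs_of_posCone_sub hsymm (hjk.mul hsymm hkl).pos ?_ hH)
  convert! ((hs j).mul hsymm (hs l)).pos.mul hA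
    (PosCone.of_site (one_sub_stepSign_sq_mem_evenOddFamily ν hr) k p) using 2
  ring

/-- $x_jx_k-r^2s_js_k=x_j(x_k-rs_k)+rs_k(x_j-rs_j)$, and $x-rs$ has the sign of $x$. -/
theorem gibbs_stepSign_le_gibbs_coord (hsymm : ν.map (fun y => -y) = ν) (hH : Ferro ν H)
    {r R : ℝ} (hR : ∀ᵐ x ∂ν, |x| ≤ R) (hr : 0 < r) (j k : κ) (p : ι) :
    r ^ 2 * (gibbs ν H fun x => stepSign r (x j p) * stepSign r (x k p)) ≤
      gibbs ν H fun x => x j p * x k p := by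
  have hA := isPositiveFamily_configFamily (κ := κ) (ι := ι) hsymm
  have hs := fun m => Ferro.stepSign (κ := κ) (ν := ν) hr m p
  have hd := fun m : κ => PosCone.of_site (sub_stepSign_mem_evenOddFamily hR hr) m p
  rw [← gibbs_const_mul]
  refine gibbs_le_gibbs_of_posCone_sub hsymm (((hs j).mul hsymm (hs k)).smul (sq_nonneg r)).pos
    ?_ hH
  convert! ((Ferro.coord (κ := κ) hR j p).pos.mul hA (hd k)).add _ _
    (((hs k).pos.smul r _ hr.le).mul hA (hd j)) using 2
  ring

/-- For the interaction `β (x_j + x_k) ^ m` with `m` even, both variables are large and of the same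
sign, up to an exponentially small correction. -/
theorem le_gibbs_stepSign_pair (hsymm : ν.map (fun y => -y) = ν) {R r b β : ℝ} {m : ℕ}
    (hm : Even m) (hR : ∀ᵐ x ∂ν, |x| ≤ R) (hr : 0 < r) (hrR : r ≤ R) (hb : 0 < b) (hβ : 0 ≤ β)
    (hδ : 0 < ∫ y, stepSign b y ^ 2 ∂ν) (j k : κ) (p : ι) :
    1 - 4 / (∫ y, stepSign b y ^ 2 ∂ν) ^ 2 * Real.exp (-(((2 * b) ^ m - (R + r) ^ m) * β)) ≤
      gibbs ν (fun x => β * (x j p + x k p) ^ m)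
        fun x => stepSign r (x j p) * stepSign r (x k p) := by
  set δ := ∫ y, stepSign b y ^ 2 ∂ν with hδdef
  have hA := isPositiveFamily_configFamily (κ := κ) (ι := ι) hsymm
  have hH : Ferro ν (fun x : κ → ι → ℝ => β * (x j p + x k p) ^ m) :=
    (((Ferro.coord hR j p).add (Ferro.coord hR k p)).pow hsymm m).smul hβ
  have hZ := hH.integral_exp_pos hsymm
  have hχ : Ferro ν (fun x : κ → ι → ℝ => stepSign r (x j p) * stepSign r (x k p)) :=
    (Ferro.stepSign hr j p).mul hsymm (Ferro.stepSign hr k p)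
  have hθ : Ferro ν (fun x : κ → ι → ℝ => stepSign b (x j p) * stepSign b (x k p)) :=
    (Ferro.stepSign hb j p).mul hsymm (Ferro.stepSign hb k p)
  have hθ2 : ∀ l : κ, Ferro ν (fun x : κ → ι → ℝ => stepSign b (x l p) ^ 2) := fun l =>
    (Ferro.stepSign hb l p).pow hsymm 2
  have hθ4 := (hθ2 j).mul hsymm (hθ2 k)
  -- The partition function is bounded below by the event that both variables are beyond `b` with
  -- equal signs, where the even power is at least `(2 * b) ^ m`.
  have hlow : Real.exp (β * (2 * b) ^ m) * (δ ^ 2 / 2) ≤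
      ∫ x, Real.exp (β * (x j p + x k p) ^ m) ∂(configLaw κ ι ν) := by
    have h1 : δ ^ 2 ≤ ∫ x, (stepSign b (x j p) * stepSign b (x k p) +
        stepSign b (x j p) ^ 2 * stepSign b (x k p) ^ 2) ∂(configLaw κ ι ν) := by
      rw [integral_add (hθ.integrable hsymm) (hθ4.integrable hsymm)]
      -- The Griffiths inequality with zero Hamiltonian replaces independence, and so also covers `j
      -- = k`.
      have h2 := gibbs_mul_le hsymm (hθ2 j) (hθ2 k) (.const (c := 0) le_rfl)
      have hmeas := (stepSign_monotone b).measurable.pow_const 2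
      rw [gibbs_zero, gibbs_zero, gibbs_zero, integral_config_site hmeas,
        integral_config_site hmeas, ← sq] at h2
      exact h2.trans (le_add_of_nonneg_left (hθ.pos.integral_nonneg hA))
    calc Real.exp (β * (2 * b) ^ m) * (δ ^ 2 / 2)
        ≤ (Real.exp (β * (2 * b) ^ m) / 2) * ∫ x, (stepSign b (x j p) * stepSign b (x k p) +
          stepSign b (x j p) ^ 2 * stepSign b (x k p) ^ 2) ∂(configLaw κ ι ν) := by
          rw [mul_div_assoc', div_mul_eq_mul_div]
          gcongr
      _ = ∫ x, (Real.exp (β * (2 * b) ^ m) / 2) * (stepSign b (x j p) * stepSign b (x k p) +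
          stepSign b (x j p) ^ 2 * stepSign b (x k p) ^ 2) ∂(configLaw κ ι ν) :=
          (integral_const_mul _ _).symm
      _ ≤ _ := by
          refine integral_mono (((hθ.add hθ4).integrable hsymm).const_mul _)
            ((hH.exp hsymm).integrable hsymm) fun x => ?_
          dsimp only
          rcases stepSign_mul_add_sq_le (r := b) (x := x j p) (y := x k p) with h | ⟨h, h'⟩
          · rw [h, mul_zero]
            positivity
          · rw [h, div_mul_cancel₀ _ two_ne_zero, ← hm.pow_abs (x j p + x k p)]
            gcongr
  -- On the complementary event the even power is at most `(R + r) ^ m`.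
  have hup : ∫ x, (1 - stepSign r (x j p) * stepSign r (x k p)) *
      Real.exp (β * (x j p + x k p) ^ m) ∂(configLaw κ ι ν) ≤
        2 * Real.exp (β * (R + r) ^ m) := by
    have hint : Integrable (fun x => (1 - stepSign r (x j p) * stepSign r (x k p)) *
        Real.exp (β * (x j p + x k p) ^ m)) (configLaw κ ι ν) := by
      simp only [sub_mul, one_mul]
      exact ((hH.exp hsymm).integrable hsymm).sub
        ((hχ.mul hsymm (hH.exp hsymm)).integrable hsymm)
    refine (integral_mono_ae hint (integrable_const (2 * Real.exp (β * (R + r) ^ m))) ?_).trans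
      (by simp)
    filter_upwards [ae_config_site hR j p, ae_config_site hR k p] with x hj hk
    rcases one_sub_stepSign_mul_le hr hrR hj hk with h | ⟨h, h'⟩
    · rw [h, zero_mul]
      positivity
    · rw [← hm.pow_abs (x j p + x k p)]
      gcongr
  have hsub : ∫ x, (1 - stepSign r (x j p) * stepSign r (x k p)) *
      Real.exp (β * (x j p + x k p) ^ m) ∂(configLaw κ ι ν) =
      ∫ x, Real.exp (β * (x j p + x k p) ^ m) ∂(configLaw κ ι ν) -
      ∫ x, stepSign r (x j p) * stepSign r (x k p) *
        Real.exp (β * (x j p + x k p) ^ m) ∂(configLaw κ ι ν) := by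
    simp only [sub_mul, one_mul]
    exact integral_sub ((hH.exp hsymm).integrable hsymm)
      ((hχ.mul hsymm (hH.exp hsymm)).integrable hsymm)
  rw [hsub] at hup
  unfold gibbs
  rw [le_div_iff₀ hZ, sub_mul, one_mul, sub_le_comm]
  refine hup.trans ?_
  calc 2 * Real.exp (β * (R + r) ^ m)
      = 4 / δ ^ 2 * Real.exp (-(((2 * b) ^ m - (R + r) ^ m) * β)) *
        (Real.exp (β * (2 * b) ^ m) * (δ ^ 2 / 2)) := by
        have : Real.exp (β * (R + r) ^ m) = Real.exp (-(((2 * b) ^ m - (R + r) ^ m) * β)) *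
            Real.exp (β * (2 * b) ^ m) := by
          rw [← Real.exp_add]
          ring_nf
        rw [this]
        field_simp
        norm_num
    _ ≤ _ := by gcongr

end Gibbs

/-! ### The walk interaction as a ferromagnetic Hamiltonian -/

section Walk

variable {d T : ℕ}

theorem walk_sub_walk_apply (φ : Fin T → Fin d → ℝ) {i j : Fin (T + 1)} (hij : i < j)
    (p : Fin d) :
    (walk φ j - walk φ i) p = ∑ k : Fin T with i.val ≤ k.val ∧ k.val < j.val, φ k p := by
  have hij' : i.val < j.val := hij
  simp only [walk, Pi.sub_apply, Finset.sum_apply, Finset.sum_filter, ← Finset.sum_sub_distrib]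
  refine Finset.sum_congr rfl fun k _ => ?_
  split_ifs <;> first | (exfalso; omega) | simp

theorem walk_last_apply (φ : Fin T → Fin d → ℝ) (p : Fin d) :
    walk φ (Fin.last T) p = ∑ k, φ k p := by
  simp [walk, Finset.sum_apply]

theorem measurable_walk : Measurable (walk : (Fin T → Fin d → ℝ) → Fin (T + 1) → Fin d → ℝ) := by
  unfold walk
  fun_prop

end Walk

/-- The remainder `(A + B) ^ n - A ^ n` is in the cone. -/
theorem Ferro.add_pow_eq {κ ι : Type*} [Fintype κ] [Fintype ι] {ν : Measure ℝ}
    [IsProbabilityMeasure ν] (hsymm : ν.map (fun y => -y) = ν) {A B : (κ → ι → ℝ) → ℝ}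
    (hA : Ferro ν A) (hB : Ferro ν B) (n : ℕ) :
    ∃ G : (κ → ι → ℝ) → ℝ, Ferro ν G ∧ ∀ x, (A x + B x) ^ n = A x ^ n + G x := by
  induction n with
  | zero => exact ⟨fun _ => 0, .const le_rfl, fun x => by simp⟩
  | succ n ih =>
    obtain ⟨G, hG, h⟩ := ih
    refine ⟨fun x => A x ^ n * B x + G x * (A x + B x),
      ((hA.pow hsymm n).mul hsymm hB).add (hG.mul hsymm (hA.add hB)), fun x => ?_⟩
    rw [pow_succ, h]
    ring

section Potential

variable {d : ℕ} {W : (Fin d → ℝ) → ℕ → ℝ} {q : ℕ} {n : ℕ → ℕ} {c : ℕ → ℕ → ℝ}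

theorem IsSelfRepelling.measurable_interaction (hW : IsSelfRepelling W q n c) (T : ℕ) :
    Measurable (interaction W : (Fin (T + 1) → Fin d → ℝ) → ℝ) := by
  unfold interaction
  refine Finset.measurable_sum _ fun i _ => Finset.measurable_sum _ fun j hj => ?_
  have hij : i.val < j.val := (Finset.mem_filter.1 hj).2
  simp only [hW.eq_sum (j.val - i.val) (by omega), Pi.sub_apply]
  fun_prop

variable {ν : Measure ℝ} [IsProbabilityMeasure ν] {T : ℕ}

theorem IsSelfRepelling.ferro_term (hsymm : ν.map (fun y => -y) = ν) {R : ℝ}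
    (hR : ∀ᵐ x ∂ν, |x| ≤ R) (hW : IsSelfRepelling W q n c) {i j : Fin (T + 1)} (hij : i < j) :
    Ferro ν fun φ : Fin T → Fin d → ℝ => W (walk φ j - walk φ i) (j.val - i.val) := by
  have hij' : i.val < j.val := hij
  have h1 : 1 ≤ j.val - i.val := by omega
  simp only [hW.eq_sum _ h1, walk_sub_walk_apply _ hij]
  exact .sum _ fun e he => .smul (hW.coeff_nonneg _ h1 e he) (.pow hsymm (.sum _ fun p _ =>
    .pow hsymm (.sum _ fun k _ => .coord hR k p) q) e)

theorem IsSelfRepelling.ferro_interaction (hsymm : ν.map (fun y => -y) = ν) {R : ℝ}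
    (hR : ∀ᵐ x ∂ν, |x| ≤ R) (hW : IsSelfRepelling W q n c) :
    Ferro ν fun φ : Fin T → Fin d → ℝ => interaction W (walk φ) :=
  .sum _ fun _ _ => .sum _ fun _ hj =>
    hW.ferro_term hsymm hR (Finset.mem_filter.1 hj).2

/-- The contribution of a single coordinate of two consecutive increments can be split off the
total interaction. -/
theorem IsSelfRepelling.interaction_eq (hsymm : ν.map (fun y => -y) = ν) {R : ℝ}
    (hR : ∀ᵐ x ∂ν, |x| ≤ R) (hW : IsSelfRepelling W q n c) {e : ℕ}
    (he : e ∈ Finset.Icc 1 (n 2)) {l l' : Fin T} (hl : l'.val = l.val + 1) (p : Fin d) :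
    ∃ G : (Fin T → Fin d → ℝ) → ℝ, Ferro ν G ∧ ∀ φ,
      interaction W (walk φ) = c e 2 * (φ l p + φ l' p) ^ (q * e) + G φ := by
  classical
  -- The increment stored at `k` leads from $x_k$ to $x_{k+1}$, so $x_{l+2}-x_l$ contains exactly
  -- those stored at `l` and `l'`.
  let i : Fin (T + 1) := ⟨l.val, by omega⟩
  let j : Fin (T + 1) := ⟨l.val + 2, by omega⟩
  have hij : i < j := by simp [i, j, Fin.lt_def]
  have hz : ∀ (φ : Fin T → Fin d → ℝ) p', (walk φ j - walk φ i) p' = φ l p' + φ l' p' := by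
    intro φ p'
    have hne : l ≠ l' := fun h => by simp [h] at hl
    have : ({k : Fin T | i.val ≤ k.val ∧ k.val < j.val} : Finset (Fin T)) = {l, l'} := by
      ext k
      simp only [i, j, Finset.mem_filter, Finset.mem_univ, true_and, Finset.mem_insert,
        Finset.mem_singleton, Fin.ext_iff]
      omega
    rw [walk_sub_walk_apply φ hij, this, Finset.sum_pair hne]
  let S : Fin d → (Fin T → Fin d → ℝ) → ℝ := fun p' φ => (φ l p' + φ l' p') ^ q
  have hS : ∀ p', Ferro ν (S p') := fun p' =>
    .pow hsymm (.add (.coord hR l p') (.coord hR l' p')) q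
  have hSrest : Ferro ν fun φ => ∑ p' ∈ Finset.univ.erase p, S p' φ := .sum _ fun p' _ => hS p'
  obtain ⟨G, hG, hGeq⟩ := (hS p).add_pow_eq hsymm hSrest e
  have hsum : ∀ φ, ∑ p', S p' φ = S p φ + ∑ p' ∈ Finset.univ.erase p, S p' φ := fun φ =>
    (Finset.add_sum_erase _ (fun p' => S p' φ) (Finset.mem_univ p)).symm
  -- The remainder collects the other coordinates in the power `e`, the other powers at this pair of
  -- times, the other end times, and the other start times.
  refine ⟨fun φ => c e 2 * G φ + ∑ e' ∈ (Finset.Icc 1 (n 2)).erase e, c e' 2 * (∑ p', S p' φ) ^ e'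
    + ∑ b ∈ ({b | i < b} : Finset (Fin (T + 1))).erase j, W (walk φ b - walk φ i) (b.val - i.val)
    + ∑ a ∈ Finset.univ.erase i, ∑ b : Fin (T + 1) with a < b,
      W (walk φ b - walk φ a) (b.val - a.val), ?_, fun φ => ?_⟩
  · refine .add (.add (.add (.smul (hW.coeff_nonneg 2 one_le_two e he) hG) (.sum _ fun e' he' => ?_))
      (.sum _ fun b hb => ?_)) (.sum _ fun a _ => .sum _ fun b hb => ?_)
    · exact .smul (hW.coeff_nonneg 2 one_le_two e' (Finset.mem_of_mem_erase he'))
        (.pow hsymm (.sum _ fun p' _ => hS p') e')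
    · exact hW.ferro_term hsymm hR (Finset.mem_filter.1 (Finset.mem_of_mem_erase hb)).2
    · exact hW.ferro_term hsymm hR (Finset.mem_filter.1 hb).2
  · have hj : j ∈ ({b | i < b} : Finset (Fin (T + 1))) := by simpa using hij
    have h2 : j.val - i.val = 2 := by simp [i, j]
    have hWij : W (walk φ j - walk φ i) (j.val - i.val) =
        ∑ e' ∈ Finset.Icc 1 (n 2), c e' 2 * (∑ p', S p' φ) ^ e' := by
      rw [h2, hW.eq_sum 2 one_le_two]
      simp only [hz, S]
    unfold interaction
    rw [← Finset.add_sum_erase _ _ (Finset.mem_univ i), ← Finset.add_sum_erase _ _ hj, hWij,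
      ← Finset.add_sum_erase _ _ he, hsum φ, hGeq, pow_mul]
    simp only [S, hsum]
    ring

theorem meanSquareDisplacement_eq_sum_gibbs (hsymm : ν.map (fun y => -y) = ν) {R : ℝ}
    (hR : ∀ᵐ x ∂ν, |x| ≤ R) (hW : IsSelfRepelling W q n c) {α : ℝ} (hα : 0 ≤ α) :
    meanSquareDisplacement d ν W α T = ∑ p : Fin d, ∑ j : Fin T, ∑ k : Fin T,
      gibbs ν (fun φ : Fin T → Fin d → ℝ => α * interaction W (walk φ))
        fun φ => φ j p * φ k p := by
  have hH := (hW.ferro_interaction (T := T) hsymm hR).smul hα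
  have hc : ∀ j k p, Ferro ν fun φ : Fin T → Fin d → ℝ => φ j p * φ k p := fun j k p =>
    (Ferro.coord hR j p).mul hsymm (.coord hR k p)
  have hmeas := (hW.measurable_interaction T).const_mul α
  have hcoord : ∀ p : Fin d, Measurable fun x : Fin (T + 1) → Fin d → ℝ => x (Fin.last T) p :=
    fun p => by fun_prop
  simp only [← gibbs_sum hsymm _ (fun k _ => (hc _ k _).pos) hH,
    ← gibbs_sum hsymm _ (fun j _ => (Ferro.sum Finset.univ fun k _ => hc j k _).pos) hH]
  rw [← gibbs_sum hsymm _ (fun p _ => (Ferro.sum Finset.univ fun j _ =>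
    Ferro.sum Finset.univ fun k _ => hc j k p).pos) hH]
  unfold meanSquareDisplacement perturbedLaw gibbs
  rw [integral_tilted]
  simp only [EuclideanSpace.norm_sq_eq, Real.norm_eq_abs, sq_abs, smul_eq_mul]
  have hZ : ∫ x, Real.exp (α * interaction W x) ∂(walkLaw d ν T) =
      ∫ φ, Real.exp (α * interaction W (walk φ)) ∂(configLaw (Fin T) (Fin d) ν) :=
    integral_map measurable_walk.aemeasurable hmeas.exp.aestronglyMeasurable
  rw [hZ, walkLaw, integral_map measurable_walk.aemeasurable, ← integral_div]
  · refine integral_congr_ae (.of_forall fun φ => ?_)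
    simp only [walk_last_apply, sq, Finset.sum_mul_sum]
    ring
  · exact ((hmeas.exp.div_const _).mul (Finset.measurable_sum _ fun p _ =>
      (hcoord p).pow_const 2)).aestronglyMeasurable

end Potential

/-! ### Tail mass below the edge of the support -/

section Support

variable {ν : Measure ℝ} [IsProbabilityMeasure ν]

/-- `R` is the maximum of `|x|` on the support. It is attained at a point of the support, so every
smaller threshold leaves positive mass beyond it. -/
theorem exists_abs_le_of_isCompact_support (hcompact : IsCompact ν.support)
    (hnondeg : ν ≠ Measure.dirac 0) :
    ∃ R > 0, (∀ᵐ x ∂ν, |x| ≤ R) ∧ ∀ b, 0 < b → b < R → 0 < ∫ y, stepSign b y ^ 2 ∂ν := by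
  obtain ⟨x₀, hx₀, hmax⟩ := hcompact.exists_isMaxOn
    (Measure.nonempty_support (IsProbabilityMeasure.ne_zero ν)) continuous_abs.continuousOn
  have hae : ∀ᵐ x ∂ν, |x| ≤ |x₀| := by
    filter_upwards [Measure.support_mem_ae (μ := ν)] with x hx using hmax hx
  refine ⟨|x₀|, ?_, hae, fun b hb hbR => ?_⟩
  · refine abs_pos.2 fun h => hnondeg ?_
    have h0 : (fun x : ℝ => x) =ᵐ[ν] fun _ => 0 := by
      filter_upwards [hae] with x hx
      simpa [h] using hx
    calc ν = ν.map (fun x => x) := Measure.map_id.symm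
      _ = ν.map (fun _ => 0) := Measure.map_congr h0
      _ = Measure.dirac 0 := by simp [Measure.map_const]
  · have hpos : 0 < ν {x | b < |x|} :=
      (Measure.mem_support_iff_forall x₀).1 hx₀ _
        ((isOpen_lt continuous_const continuous_abs).mem_nhds hbR)
    have hm : Measurable fun y => stepSign b y ^ 2 :=
      (stepSign_monotone b).measurable.pow_const 2
    rw [integral_pos_iff_support_of_nonneg (fun y => sq_nonneg _)
      (Integrable.of_bound hm.aestronglyMeasurable 1 (.of_forall fun y => by
        rw [Real.norm_eq_abs, abs_of_nonneg (sq_nonneg _), sq_le_one_iff_abs_le_one]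
        exact abs_stepSign_le_one b y))]
    refine hpos.trans_le (measure_mono fun x hx => ?_)
    have hx' : b < |x| := hx
    rw [lt_abs] at hx'
    rw [Function.mem_support, stepSign]
    split_ifs with h1 h2
    · norm_num
    · norm_num
    · rcases hx' with h | h <;> exfalso <;> linarith

end Support

/-! ### Summation along the chain and conclusion -/

/-- Only the first `T - N` rows are kept, and in each the `N` entries from the diagonal rightwards,
which all fit inside the matrix. -/
theorem sum_sum_ge_of_geometric {T N : ℕ} {a : Fin T → Fin T → ℝ} {δ ρ : ℝ}
    (ha : ∀ j k, 0 ≤ a j k)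
    (hρ : ∀ (n : ℕ) (j k : Fin T), k.val = j.val + n → δ * ρ ^ n ≤ a j k) :
    ((T - N : ℕ) : ℝ) * (δ * ∑ n ∈ Finset.range N, ρ ^ n) ≤ ∑ j, ∑ k, a j k := by
  have hrow : ∀ j : Fin (T - N), δ * ∑ n ∈ Finset.range N, ρ ^ n ≤
      ∑ k, a (Fin.castLE (Nat.sub_le T N) j) k := by
    intro j
    let e : Fin N ↪ Fin T := ⟨fun n => ⟨j.val + n.val, by omega⟩, fun x y h => by
      simpa [Fin.ext_iff] using h⟩
    calc δ * ∑ n ∈ Finset.range N, ρ ^ n = ∑ n : Fin N, δ * ρ ^ n.val := by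
          rw [Finset.mul_sum, Finset.sum_range]
      _ ≤ ∑ n : Fin N, a (Fin.castLE (Nat.sub_le T N) j) (e n) :=
          Finset.sum_le_sum fun n _ => hρ n _ _ rfl
      _ = ∑ k ∈ Finset.univ.map e, a (Fin.castLE (Nat.sub_le T N) j) k :=
          (Finset.sum_map _ _ _).symm
      _ ≤ _ := Finset.sum_le_sum_of_subset_of_nonneg (Finset.subset_univ _) fun k _ _ => ha _ k
  calc ((T - N : ℕ) : ℝ) * (δ * ∑ n ∈ Finset.range N, ρ ^ n)
      = ∑ _j : Fin (T - N), δ * ∑ n ∈ Finset.range N, ρ ^ n := by simp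
    _ ≤ ∑ j : Fin (T - N), ∑ k, a (Fin.castLE (Nat.sub_le T N) j) k :=
        Finset.sum_le_sum fun j _ => hrow j
    _ = ∑ j ∈ Finset.univ.map (Fin.castLEEmb (Nat.sub_le T N)), ∑ k, a j k :=
        (Finset.sum_map _ (Fin.castLEEmb (Nat.sub_le T N)) fun j => ∑ k, a j k).symm
    _ ≤ _ := Finset.sum_le_sum_of_subset_of_nonneg (Finset.subset_univ _) fun j _ _ =>
        Finset.sum_nonneg fun k _ => ha j k

/-- Nearest-neighbour correlations propagate along a chain. -/
theorem mul_pow_le_gibbs_stepSign {T : ℕ} {ι : Type*} [Fintype ι] {ν : Measure ℝ}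
    [IsProbabilityMeasure ν] (hsymm : ν.map (fun y => -y) = ν) {H : (Fin T → ι → ℝ) → ℝ}
    (hH : Ferro ν H) {r ρ : ℝ} (hr : 0 < r) (hρ0 : 0 ≤ ρ) (p : ι)
    (hρ : ∀ l l' : Fin T, l'.val = l.val + 1 →
      ρ ≤ gibbs ν H fun x => stepSign r (x l p) * stepSign r (x l' p))
    (n : ℕ) (j k : Fin T) (hk : k.val = j.val + n) :
    (∫ y, stepSign r y ^ 2 ∂ν) * ρ ^ n ≤
      gibbs ν H fun x => stepSign r (x j p) * stepSign r (x k p) := by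
  induction n generalizing k with
  | zero =>
    obtain rfl : k = j := Fin.ext hk
    simpa [sq] using sq_gibbs_stepSign hsymm hH hr k p
  | succ n ih =>
    let k' : Fin T := ⟨j.val + n, by omega⟩
    have h1 := ih k' rfl
    have h2 := hρ k' k (by simp only [k']; omega)
    rw [pow_succ, ← mul_assoc]
    have h0 : 0 ≤ gibbs ν H fun x => stepSign r (x j p) * stepSign r (x k' p) :=
      gibbs_nonneg hsymm ((Ferro.stepSign hr j p).mul hsymm (.stepSign hr k' p)).pos hH
    exact (mul_le_mul h1 h2 hρ0 h0).trans (gibbs_stepSign_mul_trans hsymm hH hr j k' k p)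

theorem theorem1 (d : ℕ) (hd : 1 ≤ d)
    (ν : Measure ℝ) [IsProbabilityMeasure ν]
    (hsymm : ν.map (fun y => -y) = ν) (hcompact : IsCompact ν.support)
    (hnondeg : ν ≠ Measure.dirac 0)
    (W : (Fin d → ℝ) → ℕ → ℝ) (q : ℕ) (n : ℕ → ℕ) (c : ℕ → ℕ → ℝ)
    (hW : IsSelfRepelling W q n c)
    (i : ℕ) (hi : i ∈ Finset.Icc 1 (n 2)) (hieven : Even i)
    (ζ : ℝ) (hζ : ζ = c i 2) (hζpos : 0 < ζ) :
    ∃ C > (0 : ℝ), ∃ a > (0 : ℝ), ∀ α : ℝ, 1 ≤ α →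
      ((C * Real.exp (a * ζ * α) : ℝ) : EReal) ≤
        limsup (fun T : ℕ =>
          ((1 / ((d : ℝ) * (T : ℝ)) * meanSquareDisplacement d ν W α T : ℝ) : EReal)) atTop := by
  obtain ⟨R, hR0, hR, hstep⟩ := exists_abs_le_of_isCompact_support hcompact hnondeg
  -- The choice ensures `R + r < 2 * b`, as $3/2<8/5$, which makes the rate `a` positive.
  set r := R / 2 with hr
  set b := 4 * R / 5 with hb
  have hr0 : 0 < r := by positivity
  have hb0 : 0 < b := by positivity
  have hδr := hstep r hr0 (by linarith)
  have hδb := hstep b hb0 (by linarith)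
  set δ := ∫ y, stepSign r y ^ 2 ∂ν
  set K := 4 / (∫ y, stepSign b y ^ 2 ∂ν) ^ 2 with hK
  have hK0 : 0 < K := by positivity
  have hm : Even (q * i) := hieven.mul_left q
  have hm0 : q * i ≠ 0 :=
    (Nat.mul_pos hW.one_le_exponent (Finset.mem_Icc.1 hi).1).ne'
  set a := (2 * b) ^ (q * i) - (R + r) ^ (q * i) with ha
  have ha0 : 0 < a := sub_pos.2 (pow_lt_pow_left₀ (by linarith) (by linarith) hm0)
  -- The 4 comes from two halves: `T - N ≥ T / 2`, and the geometric sum, which is at least `1 / (2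
  -- * ε)`.
  refine ⟨r ^ 2 * δ / (4 * K), by positivity, a, ha0, fun α hα => ?_⟩
  have hα0 : 0 ≤ α := zero_le_one.trans hα
  -- The cap keeps `1 - ε` nonnegative; when it is active, the correlation bound is mere positivity.
  set ε := min 1 (K * Real.exp (-(a * (α * ζ)))) with hε
  have hε0 : 0 < ε := lt_min one_pos (by positivity)
  have hε1 : ε ≤ 1 := min_le_left _ _
  -- `N` depends on `α` but not on `T`, so `T` can be taken large afterwards.
  obtain ⟨N, hN⟩ := exists_pow_lt_of_lt_one (show (0 : ℝ) < 1 / 2 by norm_num)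
    (show 1 - ε < 1 by linarith)
  have hgeom : 1 / (2 * ε) ≤ ∑ n ∈ Finset.range N, (1 - ε) ^ n := by
    have h := geom_sum_mul (1 - ε) N
    rw [div_le_iff₀ (by positivity)]
    nlinarith
  have hcorr : ∀ (T : ℕ) (p : Fin d) (m : ℕ) (j k : Fin T), k.val = j.val + m →
      δ * (1 - ε) ^ m ≤
        gibbs ν (fun φ : Fin T → Fin d → ℝ => α * interaction W (walk φ))
          fun φ => stepSign r (φ j p) * stepSign r (φ k p) := by
    intro T p
    refine mul_pow_le_gibbs_stepSign hsymm ((hW.ferro_interaction hsymm hR).smul hα0) hr0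
      (by linarith) p fun l l' hl => ?_
    obtain ⟨G, hG, hGeq⟩ := hW.interaction_eq hsymm hR hi hl p
    have hβ : 0 ≤ α * ζ := by positivity
    have hpair : Ferro ν fun φ : Fin T → Fin d → ℝ => α * ζ * (φ l p + φ l' p) ^ (q * i) :=
      (((Ferro.coord hR l p).add (.coord hR l' p)).pow hsymm _).smul hβ
    have h1 := le_gibbs_stepSign_pair hsymm hm hR hr0 (by linarith) hb0 hβ hδb l l' p
    -- Restoring the rest of the interaction can only increase the pair correlation.
    have h2 := gibbs_le_gibbs_add hsymm
      ((Ferro.stepSign hr0 l p).mul hsymm (.stepSign hr0 l' p)) (hG.smul hα0) hpair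
    have h3 : (fun φ : Fin T → Fin d → ℝ => α * interaction W (walk φ)) =
        fun φ => α * ζ * (φ l p + φ l' p) ^ (q * i) + α * G φ := by
      ext φ
      rw [hGeq, hζ]
      ring
    have h0 := gibbs_nonneg hsymm
      ((Ferro.stepSign hr0 l p).mul hsymm (.stepSign hr0 l' p)).pos hpair
    rw [h3]
    refine le_trans ?_ h2
    rcases min_choice 1 (K * Real.exp (-(a * (α * ζ)))) with h | h
    · rw [hε, h, sub_self]
      exact h0
    · rw [hε, h]
      exact h1
  refine le_limsup_of_frequently_le' (Eventually.frequently ?_)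
  filter_upwards [eventually_ge_atTop (2 * N + 1)] with T hT
  rw [EReal.coe_le_coe_iff]
  have hT0 : (0 : ℝ) < T := by exact_mod_cast (show 0 < T by omega)
  have hd0 : (0 : ℝ) < d := by exact_mod_cast hd
  have hTN : (T : ℝ) / 2 ≤ ((T - N : ℕ) : ℝ) := by
    rw [Nat.cast_sub (by omega)]
    have : (2 * N + 1 : ℝ) ≤ T := by exact_mod_cast hT
    linarith
  have hH : Ferro ν fun φ : Fin T → Fin d → ℝ => α * interaction W (walk φ) :=
    (hW.ferro_interaction hsymm hR).smul hα0
  have hcoord : ∀ p : Fin d, r ^ 2 * (T / 2 * (δ * (1 / (2 * ε)))) ≤ ∑ j : Fin T, ∑ k : Fin T,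
      gibbs ν (fun φ : Fin T → Fin d → ℝ => α * interaction W (walk φ))
        fun φ => φ j p * φ k p := by
    intro p
    have h1 := sum_sum_ge_of_geometric (N := N) (fun j k => gibbs_nonneg hsymm
      ((Ferro.stepSign hr0 j p).mul hsymm (.stepSign hr0 k p)).pos hH) (hcorr T p)
    calc r ^ 2 * (T / 2 * (δ * (1 / (2 * ε))))
        ≤ r ^ 2 * (((T - N : ℕ) : ℝ) * (δ * ∑ n ∈ Finset.range N, (1 - ε) ^ n)) := by gcongr
      _ ≤ r ^ 2 * ∑ j : Fin T, ∑ k : Fin T,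
          gibbs ν (fun φ : Fin T → Fin d → ℝ => α * interaction W (walk φ))
            fun φ => stepSign r (φ j p) * stepSign r (φ k p) := by gcongr
      _ ≤ _ := by
        simp only [Finset.mul_sum]
        exact Finset.sum_le_sum fun j _ => Finset.sum_le_sum fun k _ =>
          gibbs_stepSign_le_gibbs_coord hsymm hH hR hr0 j k p
  rw [meanSquareDisplacement_eq_sum_gibbs hsymm hR hW hα0]
  have hsum := Finset.card_nsmul_le_sum Finset.univ _ _ fun p _ => hcoord p
  rw [Finset.card_univ, Fintype.card_fin, nsmul_eq_mul] at hsum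
  have hεK : ε ≤ K * Real.exp (-(a * (α * ζ))) := min_le_right _ _
  calc r ^ 2 * δ / (4 * K) * Real.exp (a * ζ * α)
      = r ^ 2 * δ / (4 * (K * Real.exp (-(a * (α * ζ))))) := by
        rw [Real.exp_neg, show a * ζ * α = a * (α * ζ) by ring]
        field_simp
    _ ≤ r ^ 2 * δ / (4 * ε) := by gcongr
    _ = 1 / (d * T) * (d * (r ^ 2 * (T / 2 * (δ * (1 / (2 * ε)))))) := by
        field_simp
        norm_num
    _ ≤ _ := by gcongr

end
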